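/- For a finite group $G$, the group determinant of $F=\sum_{g\in G}a_g g\in\mathbb Z[G]$ is $D(F)=\det(a_{gh^{-1}})_{g,h\in G}$, and the integer group determinants for $G$ are the values $D(F)$, $F\in\mathbb Z[G]$. Let $G$ be SmallGroup(21,1), that is, the nonabelian semidirect product $$\mathbb Z_7\rtimes\mathbb Z_3=\langle X,Y : X^7=Y^3=1,\ YX=X^2Y\rangle ,$$ and for $z\in\mathbb Q(\sqrt7\, i)$ let $N(z)=|z|^2$ be the norm from $\mathbb Q(\sqrt7\, i)$ to $\mathbb Q$. 1. The integer group determinants for $G$ are exactly the integers of the form $$m\,N\left(m+7\ell+\tfrac12(7+\sqrt7\,i)\beta\right)^3,\qquad m,\ell,\beta\in\mathbb Z,\quad 3\nmid m\ \text{ or }\ 9\mid m.$$ 2. The integer group determinants for $G$ that are divisible by $7$ are exactly the integers $7^4m$ with $m\in\mathbb Z$ and $3\nmid m$ or $9\mid m$. 3. The integer group determinants for $G$ that are $\equiv\pm1\bmod 7$ are exactly the integers $m\equiv\pm1\bmod 7$ with $3\nmid m$ or $9\mid m$. 4. The integer group determinants for $G$ that are $\equiv\pm2$ or $\pm3\bmod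 7$ are exactly the integers of the form $$m\,N\left(m+7\ell+\tfrac12(7+\sqrt7\,i)\beta\right)^3,\qquad 3\nmid m\ \text{ or }\ 9\mid m,$$ with $m,\ell,\beta\in\mathbb Z$ and $m\equiv\pm2$ or $\pm3\bmod 7$. -/

import Mathlib

/-- The group determinant of `F = ∑ a_g g` in `ℤ[G]`: the determinant of the matrix
`(a_{g h⁻¹})`, with rows indexed by `g ∈ G` and columns by `h ∈ G`. -/
def groupDet {G : Type*} [Group G] [Fintype G] [DecidableEq G] (F : MonoidAlgebra ℤ G) : ℤ :=
  Matrix.det (Matrix.of fun g h : G => F.coeff (g * h⁻¹))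

/-- The set of integer group determinants of `G`. -/
def integerGroupDets (G : Type*) [Group G] [Fintype G] [DecidableEq G] : Set ℤ :=
  Set.range (groupDet (G := G))

namespace SmallGroup21

/-- The action of `ℤ/3` on `ℤ/7` in which `j` acts as multiplication by `2 ^ j`
(both groups are written multiplicatively). -/
def action : Multiplicative (ZMod 3) →* MulAut (Multiplicative (ZMod 7)) where
  toFun j :=
    { toFun := fun x => Multiplicative.ofAdd ((2 : ZMod 7) ^ j.toAdd.val * x.toAdd)
      invFun := fun x => Multiplicative.ofAdd ((4 : ZMod 7) ^ j.toAdd.val * x.toAdd)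
      left_inv := by revert j; decide
      right_inv := by revert j; decide
      map_mul' := by
        intro x y
        rw [toAdd_mul, mul_add, ofAdd_add] }
  map_one' := by ext x; revert x; decide
  map_mul' := by
    intro i j
    ext x
    revert i j x
    decide

end SmallGroup21

/-- `SmallGroup(21,1)`, the nonabelian semidirect product `ℤ/7 ⋊ ℤ/3`. -/
abbrev SmallGroup21 : Type :=
  Multiplicative (ZMod 7) ⋊[SmallGroup21.action] Multiplicative (ZMod 3)

namespace SmallGroup21

instance instFintype : Fintype SmallGroup21 :=
  Fintype.ofEquiv _ SemidirectProduct.equivProd.symm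

/-- The generator `X` of order 7. -/
def X : SmallGroup21 := SemidirectProduct.inl (Multiplicative.ofAdd 1)

/-- The generator `Y` of order 3. -/
def Y : SmallGroup21 := SemidirectProduct.inr (Multiplicative.ofAdd 1)

/-- The defining relations of the presentation
`⟨X, Y : X ^ 7 = Y ^ 3 = 1, Y X = X ^ 2 Y⟩`. -/
theorem relations : X ^ 7 = 1 ∧ Y ^ 3 = 1 ∧ Y * X = X ^ 2 * Y := by decide

theorem card_eq : Fintype.card SmallGroup21 = 21 := by decide

/-- Every element of the group has the form `X ^ i * Y ^ j`. -/
theorem exists_eq_pow_mul_pow :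
    ∀ g : SmallGroup21, ∃ i : Fin 7, ∃ j : Fin 3, g = X ^ (i : ℕ) * Y ^ (j : ℕ) := by
  decide

end SmallGroup21

/-- The integer `D` equals `m · N(m + 7 ℓ + (7 + √7 i) β / 2) ^ 3`, where `N(z) = |z| ^ 2` is the
norm of the imaginary quadratic field `ℚ(√7 i)`. -/
def IsNormForm21 (m ℓ β D : ℤ) : Prop :=
  (D : ℝ) = (m : ℝ) * Complex.normSq
    ((m : ℂ) + 7 * (ℓ : ℂ) + (1 / 2 : ℂ) * (7 + (Real.sqrt 7 : ℂ) * Complex.I) * (β : ℂ)) ^ 3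

namespace SmallGroup21

open Matrix

/-! Fourier transform over the normal subgroup `ℤ/7` splits the group determinant into seven 3×3
determinants, the values at the characters of `ℤ/7` of one element of `ℤ[ℤ/7]`, the determinant of
`block` (`groupDet_eq_prod`). Conjugation by `Y` makes that element invariant under `u ↦ 4u`, so its
coefficients are constants `d`, `s`, `t` on the orbits {0}, {1,2,4}, {3,5,6}. The trivial character
gives `m = d + 3s + 3t`; the other six give two conjugate values in ℚ(√-7), three times each, hence
`m N ^ 3`. At the trivial character the block is an integer circulant, which forces `3 ∤ m` or `9 ∣
m`. Conversely, explicit elements realise every admissible triple (`exists_groupDet_eq`), and the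
statements modulo 7 follow from `N ≡ m² mod 7`. -/

/-- The element `X ^ u * Y ^ j`. -/
def mk (j : ZMod 3) (u : ZMod 7) : SmallGroup21 := ⟨Multiplicative.ofAdd u, Multiplicative.ofAdd j⟩

/-- Coordinates on the group. -/
def coordEquiv : SmallGroup21 ≃ ZMod 3 × ZMod 7 where
  toFun g := (g.right.toAdd, g.left.toAdd)
  invFun p := mk p.1 p.2
  left_inv _ := rfl
  right_inv _ := rfl

/-- The automorphism by which conjugation by `Y ^ (-i)` acts on exponents of `X`. -/
def twist (i : ZMod 3) : ZMod 7 := 4 ^ i.val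

theorem mk_mul_inv (j i : ZMod 3) (u v : ZMod 7) :
    mk j u * (mk i v)⁻¹ = mk (j - i) (u - twist (i - j) * v) := by
  revert j i u v; decide

/-- The matrix with entries in `ℤ[ℤ/7]` that describes multiplication by
`∑ a j u • X ^ u * Y ^ j`. -/
noncomputable def block (a : ZMod 3 → ZMod 7 → ℤ) :
    Matrix (ZMod 3) (ZMod 3) (AddMonoidAlgebra ℤ (ZMod 7)) :=
  of fun i j => ∑ u, AddMonoidAlgebra.single (twist i * u) (a (i - j) u)

/-- The `k`-th character of `ℤ/7`, extended to the group ring. -/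
noncomputable def charEval (k : ZMod 7) : AddMonoidAlgebra ℤ (ZMod 7) →ₐ[ℤ] ℂ :=
  AddMonoidAlgebra.lift ℤ ℂ (ZMod 7) (AddChar.mulShift ZMod.stdAddChar k).toMonoidHom

theorem charEval_single (k u : ZMod 7) (n : ℤ) :
    charEval k (AddMonoidAlgebra.single u n) = n * ZMod.stdAddChar (k * u) := by
  simp [charEval]

theorem charEval_block (a : ZMod 3 → ZMod 7 → ℤ) (k : ZMod 7) (i j : ZMod 3) :
    charEval k (block a i j) = ∑ u, (a (i - j) u : ℂ) * ZMod.stdAddChar (k * (twist i * u)) := by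
  simp [block, charEval_single]

/-! ### Block diagonalisation by characters of `ℤ/7`. -/

/-- The Fourier matrix adapted to the action. -/
noncomputable def fourier (ε : ZMod 7) : Matrix (ZMod 3 × ZMod 7) (ZMod 3 × ZMod 7) ℂ :=
  of fun p q => if p.1 = q.1 then ZMod.stdAddChar (ε * q.2 * (twist p.1 * p.2)) else 0

theorem isUnit_twist (i : ZMod 3) : IsUnit (twist i) :=
  isUnit_iff_exists_inv.mpr (by revert i; decide)

theorem transpose_fourier_mul_fourier : (fourier 1)ᵀ * fourier (-1) =
    (7 : ℂ) • (1 : Matrix (ZMod 3 × ZMod 7) (ZMod 3 × ZMod 7) ℂ) := by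
  ext ⟨i, k⟩ ⟨j, l⟩
  have h := AddChar.sum_mulShift (twist i * (k - l)) (ZMod.isPrimitive_stdAddChar 7)
  by_cases hij : i = j
  · subst hij
    simp only [mul_apply, fourier, transpose_apply, of_apply, Fintype.sum_prod_type, ite_mul,
      mul_ite, zero_mul, mul_zero, Matrix.smul_apply, one_apply, Prod.mk.injEq, true_and,
      smul_eq_mul]
    rw [Finset.sum_eq_single i]
    · simp only [if_true, ← AddChar.map_add_eq_mul]
      calc _ = _ := Finset.sum_congr rfl fun x _ => by congr 1; ring
        _ = _ := h
        _ = _ := by simp [(isUnit_twist i).mul_right_eq_zero, sub_eq_zero]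
    · intro b _ hb; simp [hb]
    · simp
  · simp only [mul_apply, fourier, transpose_apply, of_apply, Fintype.sum_prod_type, ite_mul,
      mul_ite, zero_mul, mul_zero, Matrix.smul_apply, one_apply, Prod.mk.injEq, smul_eq_mul]
    rw [if_neg (by tauto)]
    refine Finset.sum_eq_zero fun x _ => Finset.sum_eq_zero fun y _ => ?_
    split_ifs with h1 h2 <;> first
      | rfl
      | exact absurd (h2.symm.trans h1) hij

theorem det_fourier_ne_zero : (fourier (-1)).det ≠ 0 := by
  intro h
  have := congrArg det transpose_fourier_mul_fourier
  rw [det_mul, h, mul_zero, det_smul, det_one, mul_one] at this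
  exact pow_ne_zero _ (by norm_num) this.symm

theorem twist_sub_mul (i j : ZMod 3) : twist j = twist i * twist (j - i) := by
  revert i j; decide

/-- Substituting `u = x - twist (j - i) * y` and using `twist j = twist i * twist (j - i)` splits
off the phase of `x` and leaves the frequency `k` unchanged, so distinct frequencies do not mix. -/
theorem mul_fourier (a : ZMod 3 → ZMod 7 → ℤ) :
    (of fun p q : ZMod 3 × ZMod 7 => (a (p.1 - q.1) (p.2 - twist (q.1 - p.1) * q.2) : ℂ)) *
      fourier (-1) = fourier (-1) * blockDiagonal fun k => (charEval k).mapMatrix (block a) := by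
  ext ⟨i, x⟩ ⟨j, k⟩
  have hu : IsUnit (twist (j - i)) := isUnit_twist _
  have hl : ∑ y, (a (i - j) (x - twist (j - i) * y) : ℂ) *
      ZMod.stdAddChar (-1 * k * (twist j * y)) =
      ∑ u, (a (i - j) u : ℂ) * ZMod.stdAddChar (k * (twist i * u) + -1 * k * (twist i * x)) := by
    refine Fintype.sum_bijective (fun y => x - twist (j - i) * y) ?_ _ _ fun y => ?_
    · exact (Equiv.subLeft x).bijective.comp (IsUnit.isUnit_iff_mulLeft_bijective.mp hu)
    · rw [twist_sub_mul i j]; congr 2; ring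
  simp only [mul_apply, fourier, of_apply, Fintype.sum_prod_type, blockDiagonal_apply, ite_mul,
      mul_ite, zero_mul, mul_zero]
  rw [Finset.sum_eq_single j (by intro b _ hb; simp [hb]) (by simp),
    Finset.sum_eq_single i (by intro b _ hb; simp [Ne.symm hb]) (by simp)]
  simp only [if_true, Finset.sum_ite_eq', Finset.mem_univ, AlgHom.mapMatrix_apply, map_apply]
  rw [hl, charEval_block, Finset.mul_sum]
  exact Finset.sum_congr rfl fun u _ => by rw [AddChar.map_add_eq_mul]; ring

theorem groupDet_eq_prod (F : MonoidAlgebra ℤ SmallGroup21) :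
    (groupDet F : ℂ) = ∏ k, charEval k (block fun j u => F.coeff (mk j u)).det := by
  set a : ZMod 3 → ZMod 7 → ℤ := fun j u => F.coeff (mk j u)
  have h := congrArg det (mul_fourier a)
  rw [det_mul, det_mul, mul_comm, det_blockDiagonal] at h
  have h2 := mul_left_cancel₀ det_fourier_ne_zero h
  simp only [AlgHom.map_det]
  rw [← h2, groupDet, ← det_submatrix_equiv_self coordEquiv.symm]
  refine (RingHom.map_det (Int.castRingHom ℂ) _).trans ?_
  congr 1
  ext p q
  simp only [RingHom.mapMatrix_apply, map_apply, submatrix_apply, of_apply]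
  rw [show coordEquiv.symm p = mk p.1 p.2 from rfl, show coordEquiv.symm q = mk q.1 q.2 from rfl,
    mk_mul_inv]
  rfl

/-! ### Invariance of the block determinant. -/

/-- The ring homomorphism of `ℤ[ℤ/7]` given by `u ↦ 4 u`. -/
noncomputable def twistHom : AddMonoidAlgebra ℤ (ZMod 7) →+* AddMonoidAlgebra ℤ (ZMod 7) :=
  AddMonoidAlgebra.mapDomainRingHom ℤ (AddMonoidHom.mulLeft (4 : ZMod 7))

/-- Applying `u ↦ 4u` to the entries shifts rows and columns together by one: `i - j` is unchanged
and `twist (i + 1) = 4 * twist i`, cyclically since `4 ^ 3 = 1`. -/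
theorem twistHom_det_block (a : ZMod 3 → ZMod 7 → ℤ) :
    twistHom (block a).det = (block a).det := by
  rw [RingHom.map_det, ← det_submatrix_equiv_self (Equiv.addRight (1 : ZMod 3)) (block a)]
  congr 1
  ext1 i j
  have ht : twist (i + 1) = 4 * twist i := by revert i; decide
  simp [block, twistHom, ht, mul_assoc]

theorem coeff_det_block (a : ZMod 3 → ZMod 7 → ℤ) (u : ZMod 7) :
    (block a).det.coeff (4 * u) = (block a).det.coeff u := by
  conv_lhs => rw [← twistHom_det_block]
  have hinj : Function.Injective (fun u : ZMod 7 => 4 * u) := by decide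
  exact Finsupp.mapDomain_apply hinj _ u

theorem stdAddChar_eq_pow (k : ZMod 7) (n : ℕ) :
    ZMod.stdAddChar (k * (n : ZMod 7)) = (ZMod.stdAddChar k : ℂ) ^ n := by
  rw [← AddChar.map_nsmul_eq_pow, nsmul_eq_mul, mul_comm]

theorem stdAddChar_pow_seven (k : ZMod 7) : (ZMod.stdAddChar k : ℂ) ^ 7 = 1 := by
  rw [← stdAddChar_eq_pow, show ((7 : ℕ) : ZMod 7) = 0 by decide, mul_zero, AddChar.map_zero_eq_one]

theorem exists_charEval_det_block (a : ZMod 3 → ZMod 7 → ℤ) : ∃ d s t : ℤ, ∀ k,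
    let w : ℂ := ZMod.stdAddChar k
    charEval k (block a).det = d + s * (w + w ^ 2 + w ^ 4) + t * (w ^ 3 + w ^ 5 + w ^ 6) := by
  set c := (block a).det
  refine ⟨c.coeff 0, c.coeff 1, c.coeff 3, fun k => ?_⟩
  have h4 : c.coeff 4 = c.coeff 1 := coeff_det_block a 1
  have h2 : c.coeff 2 = c.coeff 4 := coeff_det_block a 4
  have h5 : c.coeff 5 = c.coeff 3 := coeff_det_block a 3
  have h6 : c.coeff 6 = c.coeff 5 := coeff_det_block a 5
  have hs : charEval k c = ∑ u, (c.coeff u : ℂ) * ZMod.stdAddChar (k * u) := by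
    rw [charEval, AddMonoidAlgebra.lift_apply', Finsupp.sum_fintype _ _ (by simp)]
    simp
  rw [hs, show (∑ u, (c.coeff u : ℂ) * ZMod.stdAddChar (k * u)) =
      ∑ n : Fin 7, (c.coeff ((n : ℕ) : ZMod 7) : ℂ) * ZMod.stdAddChar (k * ((n : ℕ) : ZMod 7)) from
    Finset.sum_congr rfl fun u _ => by
      rw [show ((Fin.val u : ℕ) : ZMod 7) = u from ZMod.natCast_zmod_val (n := 7) u]]
  simp only [stdAddChar_eq_pow, Fin.sum_univ_seven]
  norm_num
  rw [h6, h5, h2, h4]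
  ring

/-- The polynomial function with coefficients `c`. -/
noncomputable def coeffPoly (c : ZMod 7 → ℤ) (z : ℂ) : ℂ :=
  c 0 + c 1 * z + c 2 * z ^ 2 + c 3 * z ^ 3 + c 4 * z ^ 4 + c 5 * z ^ 5 + c 6 * z ^ 6

/-- The determinant of the block attached to the value `w` of a character, in terms of the
polynomials `p`, `q`, `r` that multiply `1`, `Y`, `Y ^ 2`. -/
def blockDet (p q r : ℂ → ℂ) (w : ℂ) : ℂ :=
  p w * p (w ^ 4) * p (w ^ 2) + q w * q (w ^ 4) * q (w ^ 2) + r w * r (w ^ 4) * r (w ^ 2) -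
    p w * r (w ^ 4) * q (w ^ 2) - r w * q (w ^ 4) * p (w ^ 2) - q w * p (w ^ 4) * r (w ^ 2)

theorem sum_mul_stdAddChar (c : ZMod 7 → ℤ) (k : ZMod 7) (e : ℕ) :
    ∑ u, (c u : ℂ) * ZMod.stdAddChar (k * ((e : ZMod 7) * u)) =
      coeffPoly c (ZMod.stdAddChar k ^ e) := by
  have h (u : ZMod 7) : (c u : ℂ) * ZMod.stdAddChar (k * ((e : ZMod 7) * u)) =
      c u * (ZMod.stdAddChar k ^ e) ^ u.val := by
    rw [← pow_mul, ← stdAddChar_eq_pow, Nat.cast_mul, ZMod.natCast_zmod_val]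
  simp only [h]
  refine (Fin.sum_univ_seven _).trans ?_
  generalize (ZMod.stdAddChar k : ℂ) ^ e = z
  change _ * z ^ 0 + _ * z ^ 1 + _ * z ^ 2 + _ * z ^ 3 + _ * z ^ 4 + _ * z ^ 5 + _ * z ^ 6 = _
  rw [pow_zero, pow_one, mul_one]
  rfl

theorem charEval_det_block (a : ZMod 3 → ZMod 7 → ℤ) (k : ZMod 7) :
    charEval k (block a).det =
      blockDet (coeffPoly (a 0)) (coeffPoly (a 1)) (coeffPoly (a 2)) (ZMod.stdAddChar k) := by
  have h0 (j) : charEval k (block a 0 j) = coeffPoly (a (0 - j)) (ZMod.stdAddChar k) := by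
    rw [charEval_block, ← pow_one (ZMod.stdAddChar k : ℂ)]; exact sum_mul_stdAddChar _ k 1
  have h1 (j) : charEval k (block a 1 j) = coeffPoly (a (1 - j)) (ZMod.stdAddChar k ^ 4) := by
    rw [charEval_block]; exact sum_mul_stdAddChar _ k 4
  have h2 (j) : charEval k (block a 2 j) = coeffPoly (a (2 - j)) (ZMod.stdAddChar k ^ 2) := by
    rw [charEval_block]; exact sum_mul_stdAddChar _ k 2
  have hdet : (block a).det =
      block a 0 0 * block a 1 1 * block a 2 2 - block a 0 0 * block a 1 2 * block a 2 1
      - block a 0 1 * block a 1 0 * block a 2 2 + block a 0 1 * block a 1 2 * block a 2 0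
      + block a 0 2 * block a 1 0 * block a 2 1 - block a 0 2 * block a 1 1 * block a 2 0 :=
    det_fin_three _
  rw [hdet]
  simp only [map_add, map_sub, map_mul, h0, h1, h2, show (0 - 0 : ZMod 3) = 0 by decide,
    show (0 - 1 : ZMod 3) = 2 by decide,
    show (0 - 2 : ZMod 3) = 1 by decide, show (1 - 0 : ZMod 3) = 1 by decide,
    show (1 - 1 : ZMod 3) = 0 by decide, show (1 - 2 : ZMod 3) = 2 by decide,
    show (2 - 0 : ZMod 3) = 2 by decide, show (2 - 1 : ZMod 3) = 1 by decide,
    show (2 - 2 : ZMod 3) = 0 by decide, blockDet]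
  ring

/-! ### The norm form and the necessary conditions. -/

/-- The norm form `N(M + (7 + √7 i) β / 2)`. -/
def norm7 (M β : ℤ) : ℤ := M ^ 2 + 7 * M * β + 14 * β ^ 2

theorem groupDet_eq_of_charEval {F : MonoidAlgebra ℤ SmallGroup21} {d s t : ℤ}
    (h : ∀ k, let w : ℂ := ZMod.stdAddChar k
      charEval k (block fun j u => F.coeff (mk j u)).det =
        d + s * (w + w ^ 2 + w ^ 4) + t * (w ^ 3 + w ^ 5 + w ^ 6)) :
    groupDet F = (d + 3 * s + 3 * t) * norm7 (d + 3 * s + 3 * t + 7 * (-s)) (s - t) ^ 3 := by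
  set ω : ℂ := ZMod.stdAddChar (1 : ZMod 7) with hω
  have h7 : ω ^ 7 = 1 := stdAddChar_pow_seven 1
  have h1 : ω ≠ 1 := by
    rw [hω, ← AddChar.map_zero_eq_one (ZMod.stdAddChar (N := 7))]
    exact fun h => absurd (ZMod.injective_stdAddChar (N := 7) h) (by decide)
  have hs : 1 + ω + ω ^ 2 + ω ^ 3 + ω ^ 4 + ω ^ 5 + ω ^ 6 = 0 := by
    refine mul_left_cancel₀ (sub_ne_zero.mpr h1) ?_
    linear_combination h7
  have hpow (n : ℕ) : ZMod.stdAddChar ((n : ZMod 7)) = ω ^ n := by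
    rw [hω, ← stdAddChar_eq_pow, one_mul]
  clear_value ω
  -- `η` is a quadratic Gauss period, with conjugate `-1 - η` and norm 2.
  obtain ⟨η, hη⟩ : ∃ η, η = ω + ω ^ 2 + ω ^ 4 := ⟨_, rfl⟩
  have hη2 : η * (-1 - η) = 2 := by
    rw [hη]; linear_combination -2 * hs - ω * h7
  have hη' : ω ^ 3 + ω ^ 5 + ω ^ 6 = -1 - η := by rw [hη]; linear_combination hs
  -- Quadratic residues mod 7 fix the two periods; nonresidues, in `e'`, swap them.
  have e (n : ℕ) (hn : n = 1 ∨ n = 2 ∨ n = 4) :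
      charEval (n : ZMod 7) (block fun j u => F.coeff (mk j u)).det = d + s * η + t * (-1 - η) := by
    rw [h, hpow, ← hη', hη]
    rcases hn with rfl | rfl | rfl
    · linear_combination (0 : ℂ) * h7
    · linear_combination (s * ω + t * (ω ^ 3 + ω ^ 5)) * h7
    · linear_combination (s * (ω + ω ^ 2 * (ω ^ 7 + 1)) +
        t * (ω ^ 5 + ω ^ 6 * (ω ^ 7 + 1) + ω ^ 3 * (ω ^ 14 + ω ^ 7 + 1))) * h7
  have e' (n : ℕ) (hn : n = 3 ∨ n = 5 ∨ n = 6) :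
      charEval (n : ZMod 7) (block fun j u => F.coeff (mk j u)).det = d + s * (-1 - η) + t * η := by
    rw [h, hpow, ← hη', hη]
    rcases hn with rfl | rfl | rfl
    · linear_combination (s * ω ^ 5 + t * (ω ^ 2 + (ω + ω ^ 4) * (ω ^ 7 + 1))) * h7
    · linear_combination (s * (ω ^ 3 + ω ^ 6 * (ω ^ 7 + 1)) + t * (ω * (ω ^ 7 + 1) +
        ω ^ 4 * (ω ^ 14 + ω ^ 7 + 1) + ω ^ 2 * (ω ^ 21 + ω ^ 14 + ω ^ 7 + 1))) * h7
    · linear_combination (s * (ω ^ 5 + ω ^ 3 * (ω ^ 14 + ω ^ 7 + 1)) + t * (ω ^ 4 * (ω ^ 7 + 1) +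
        ω ^ 2 * (ω ^ 21 + ω ^ 14 + ω ^ 7 + 1) +
        ω * (ω ^ 28 + ω ^ 21 + ω ^ 14 + ω ^ 7 + 1))) * h7
  have e0 : charEval 0 (block fun j u => F.coeff (mk j u)).det = d + 3 * s + 3 * t := by
    rw [h, AddChar.map_zero_eq_one]; ring
  have hp := groupDet_eq_prod F
  rw [show (∏ k, charEval k (block fun j u => F.coeff (mk j u)).det) = _ from
    Fin.prod_univ_seven _] at hp
  have hp' := hp.trans (congrArg₂ _ (congrArg₂ _ (congrArg₂ _ (congrArg₂ _ (congrArg₂ _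
    (congrArg₂ _ e0 (e 1 (by simp))) (e 2 (by simp))) (e' 3 (by simp))) (e 4 (by simp)))
    (e' 5 (by simp))) (e' 6 (by simp)))
  have hN : ((norm7 (d + 3 * s + 3 * t + 7 * (-s)) (s - t) : ℤ) : ℂ) =
      (d + s * η + t * (-1 - η)) * (d + s * (-1 - η) + t * η) := by
    rw [norm7]; push_cast
    linear_combination (-(s - t) ^ 2 : ℂ) * hη2
  have : (groupDet F : ℂ) = ((d + 3 * s + 3 * t) *
      norm7 (d + 3 * s + 3 * t + 7 * (-s)) (s - t) ^ 3 : ℤ) := by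
    rw [hp']; push_cast [hN]; ring
  exact_mod_cast this

theorem isNormForm21_iff (m ℓ β D : ℤ) :
    IsNormForm21 m ℓ β D ↔ D = m * norm7 (m + 7 * ℓ) β ^ 3 := by
  have h7 : Real.sqrt 7 ^ 2 = 7 := Real.sq_sqrt (by norm_num)
  have : Complex.normSq ((m : ℂ) + 7 * (ℓ : ℂ) +
      (1 / 2 : ℂ) * (7 + (Real.sqrt 7 : ℂ) * Complex.I) * (β : ℂ)) =
      (norm7 (m + 7 * ℓ) β : ℤ) := by
    have hz : ((m : ℂ) + 7 * (ℓ : ℂ) +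
        (1 / 2 : ℂ) * (7 + (Real.sqrt 7 : ℂ) * Complex.I) * (β : ℂ)) =
        ((m + 7 * ℓ + 7 / 2 * β : ℝ) : ℂ) + ((Real.sqrt 7 / 2 * β : ℝ) : ℂ) * Complex.I := by
      push_cast; ring
    rw [hz, Complex.normSq_add_mul_I, norm7]
    push_cast
    linear_combination (β ^ 2 / 4 : ℝ) * h7
  rw [IsNormForm21, this]
  exact_mod_cast Iff.rfl

/-- With `S = x + y + z`, the form is `S * (S ^ 2 - 3 * (xy + yz + zx))`, congruent to `S ^ 3` mod
3; if 3 divides `S`, it divides both factors. -/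
theorem not_three_dvd_or_nine_dvd_circulant (x y z : ℤ) :
    ¬ 3 ∣ x ^ 3 + y ^ 3 + z ^ 3 - 3 * x * y * z ∨ 9 ∣ x ^ 3 + y ^ 3 + z ^ 3 - 3 * x * y * z := by
  by_cases h : (3 : ℤ) ∣ x ^ 3 + y ^ 3 + z ^ 3 - 3 * x * y * z
  · right
    have h3 : (3 : ℤ) ∣ (x + y + z) ^ 3 := by
      rw [show (x + y + z) ^ 3 = x ^ 3 + y ^ 3 + z ^ 3 - 3 * x * y * z +
        3 * ((x + y + z) * (x * y + y * z + z * x)) by ring]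
      exact dvd_add h (dvd_mul_right _ _)
    obtain ⟨c, hc⟩ := Int.prime_three.dvd_of_dvd_pow h3
    refine ⟨c * (3 * c ^ 2 - (x * y + y * z + z * x)), ?_⟩
    rw [show x ^ 3 + y ^ 3 + z ^ 3 - 3 * x * y * z =
      (x + y + z) * ((x + y + z) ^ 2 - 3 * (x * y + y * z + z * x)) by ring, hc]
    ring
  · exact Or.inl h

/-- The sign is that of an odd order, 21; this reduces `m ≡ 2` to `m ≡ 1` mod 3. -/
theorem groupDet_neg (F : MonoidAlgebra ℤ SmallGroup21) : groupDet (-F) = -groupDet F := by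
  have : (of fun g h : SmallGroup21 => (-F).coeff (g * h⁻¹)) =
      -(of fun g h : SmallGroup21 => F.coeff (g * h⁻¹)) := rfl
  rw [groupDet, this, det_neg, card_eq, groupDet]
  norm_num

theorem exists_eq_of_groupDet (F : MonoidAlgebra ℤ SmallGroup21) :
    ∃ m ℓ β : ℤ, (¬ 3 ∣ m ∨ 9 ∣ m) ∧ groupDet F = m * norm7 (m + 7 * ℓ) β ^ 3 := by
  obtain ⟨d, s, t, h⟩ := exists_charEval_det_block fun j u => F.coeff (mk j u)
  refine ⟨_, _, _, ?_, groupDet_eq_of_charEval h⟩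
  have hc (c : ZMod 7 → ℤ) : ∃ x : ℤ, coeffPoly c 1 = x :=
    ⟨c 0 + c 1 + c 2 + c 3 + c 4 + c 5 + c 6, by simp [coeffPoly]⟩
  obtain ⟨x, hx⟩ := hc fun u => F.coeff (mk 0 u)
  obtain ⟨y, hy⟩ := hc fun u => F.coeff (mk 1 u)
  obtain ⟨z, hz⟩ := hc fun u => F.coeff (mk 2 u)
  have h0 := h 0
  simp only [charEval_det_block, AddChar.map_zero_eq_one, one_pow, blockDet, hx, hy, hz] at h0
  have hA : d + 3 * s + 3 * t = x ^ 3 + y ^ 3 + z ^ 3 - 3 * x * y * z := by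
    rw [← Int.cast_inj (α := ℂ)]
    push_cast
    linear_combination -h0
  rw [hA]
  exact not_three_dvd_or_nine_dvd_circulant _ _ _

/-! ### Elements realising all admissible values. -/

/-- The element `p(X) + q(X) Y + r(X) Y ^ 2` of the group ring, where the lists of coefficients of
`p`, `q` and `r` are given. -/
noncomputable def ofCoeffs (p q r : ZMod 7 → ℤ) : MonoidAlgebra ℤ SmallGroup21 :=
  .ofCoeff (Finsupp.equivFunOnFinite.symm fun g =>
    (![p, q, r] : Fin 3 → ZMod 7 → ℤ) g.right.toAdd g.left.toAdd)

theorem groupDet_ofCoeffs {p q r : ZMod 7 → ℤ} {d s t : ℤ}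
    (h : ∀ w : ℂ, w ^ 7 = 1 → blockDet (coeffPoly p) (coeffPoly q) (coeffPoly r) w =
      d + s * (w + w ^ 2 + w ^ 4) + t * (w ^ 3 + w ^ 5 + w ^ 6)) :
    groupDet (ofCoeffs p q r) =
      (d + 3 * s + 3 * t) * norm7 (d + 3 * s + 3 * t + 7 * (-s)) (s - t) ^ 3 := by
  refine groupDet_eq_of_charEval fun k => ?_
  rw [charEval_det_block]
  exact h _ (stdAddChar_pow_seven k)

/-- A vector, regarded as a function on `ℤ/7`. -/
def ofVec (v : Fin 7 → ℤ) : ZMod 7 → ℤ := v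

theorem coeffPoly_ofVec (c₀ c₁ c₂ c₃ c₄ c₅ c₆ : ℤ) (z : ℂ) :
    coeffPoly (ofVec ![c₀, c₁, c₂, c₃, c₄, c₅, c₆]) z =
      c₀ + c₁ * z + c₂ * z ^ 2 + c₃ * z ^ 3 + c₄ * z ^ 4 + c₅ * z ^ 5 + c₆ * z ^ 6 := rfl

theorem exists_groupDet_eq_of_three_mul_add_one (k ℓ β : ℤ) : ∃ F : MonoidAlgebra ℤ SmallGroup21,
    groupDet F = (3 * k + 1) * norm7 (3 * k + 1 + 7 * ℓ) β ^ 3 := by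
  obtain ⟨s, rfl⟩ : ∃ s, ℓ = -s := ⟨-ℓ, by ring⟩
  obtain ⟨t, rfl⟩ : ∃ t, β = s - t := ⟨s - β, by ring⟩
  obtain ⟨f, rfl⟩ : ∃ f, k = f + s + t := ⟨k - s - t, by ring⟩
  -- This is `1 + h(X) (1 + Y + Y ^ 2)` with `h = f + s X + t X ^ 3`. Its block is a rank-one update
  -- of the identity, with determinant `1 + h(w) + h(w ^ 2) + h(w ^ 4)`.
  refine ⟨ofCoeffs (ofVec ![1 + f, s, 0, t, 0, 0, 0]) (ofVec ![f, s, 0, t, 0, 0, 0])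
    (ofVec ![f, s, 0, t, 0, 0, 0]), ?_⟩
  rw [groupDet_ofCoeffs (d := 1 + 3 * f) (s := s) (t := t)]
  · ring_nf
  intro w hw
  simp only [blockDet, coeffPoly_ofVec]
  push_cast
  linear_combination w ^ 5 * t * hw

theorem exists_groupDet_eq_of_nine_mul (k ℓ β : ℤ) : ∃ F : MonoidAlgebra ℤ SmallGroup21,
    groupDet F = 9 * k * norm7 (9 * k + 7 * ℓ) β ^ 3 := by
  obtain ⟨s, rfl⟩ : ∃ s, ℓ = -s := ⟨-ℓ, by ring⟩
  obtain ⟨t, rfl⟩ : ∃ t, β = s - t := ⟨s - β, by ring⟩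
  obtain ⟨b, rfl⟩ : ∃ b, t = -1 + 2 * k + b := ⟨t + 1 - 2 * k, by ring⟩
  obtain ⟨a, rfl⟩ : ∃ a, s = 1 - a - b := ⟨1 - s - b, by ring⟩
  -- This is `h(X) (1 + Y + Y ^ 2) + (1 + X) Y + X ^ 4 Y ^ 2` with `h = k + a + b - 1 - a X ^ 3 - b
  -- X ^ 4`. The determinant is affine in `h`, and at `X = 1` it is the circulant of `k - 1, k + 1,
  -- k`, namely `9k`.
  refine ⟨ofCoeffs (ofVec ![k + a + b - 1, 0, 0, -a, -b, 0, 0])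
    (ofVec ![k + a + b, 1, 0, -a, -b, 0, 0])
    (ofVec ![k + a + b - 1, 0, 0, -a, 1 - b, 0, 0]), ?_⟩
  rw [groupDet_ofCoeffs (d := 3 * k + 3 * a) (s := 1 - a - b) (t := -1 + 2 * k + b)]
  · ring_nf
  intro w hw
  simp only [blockDet, coeffPoly_ofVec]
  push_cast
  linear_combination ((2 - 3 * b) + w * (-3 * b - 2 * k - 3 * a + 2) + w ^ 2 * (-3 * a - 2 * k
    - 3 * b + 2) + w ^ 3 * (k - 1) + w ^ 4 * (-2 * a - k - b + 1) + w ^ 5 * (k - 1) + w ^ 6 * (b +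
    k - 1) + w ^ 7 * (2 * a - 3 * b + 1) + w ^ 8 * (-a + b) + w ^ 9 * (-b - k + 1 - a) + w ^ 10 *
    (b + k - 1) + w ^ 11 * (-k - a - b + 1) + w ^ 12 * (-b) + w ^ 13 * (2 * b + k + a - 1) + w ^
    14 * (2 * a - 3 * b + 1) + w ^ 15 * (b) + w ^ 17 * (k + 2 * b - 1) + w ^ 18 * (b) + w ^ 19 *
    (-a) + w ^ 20 * (-a) + w ^ 21 * (-3 * b + 1)) * hw

theorem exists_groupDet_eq {m : ℤ} (hm : ¬ 3 ∣ m ∨ 9 ∣ m) (ℓ β : ℤ) :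
    ∃ F : MonoidAlgebra ℤ SmallGroup21, groupDet F = m * norm7 (m + 7 * ℓ) β ^ 3 := by
  rcases hm with hm | ⟨k, rfl⟩
  · obtain ⟨k, rfl | rfl⟩ : ∃ k, m = 3 * k + 1 ∨ m = -(3 * k + 1) := by
      rcases (by omega : m % 3 = 1 ∨ m % 3 = 2) with h | h
      · exact ⟨m / 3, by omega⟩
      · exact ⟨-(m / 3) - 1, by omega⟩
    · exact exists_groupDet_eq_of_three_mul_add_one k ℓ β
    · obtain ⟨F, hF⟩ := exists_groupDet_eq_of_three_mul_add_one k (-ℓ) (-β)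
      refine ⟨-F, ?_⟩
      rw [groupDet_neg, hF, norm7, norm7]
      ring
  · exact exists_groupDet_eq_of_nine_mul k ℓ β

/-! ### Assembly and residues modulo 7. -/

theorem integerGroupDets_eq : integerGroupDets SmallGroup21 =
    {D : ℤ | ∃ m ℓ β : ℤ, (¬ 3 ∣ m ∨ 9 ∣ m) ∧ D = m * norm7 (m + 7 * ℓ) β ^ 3} := by
  ext D
  constructor
  · rintro ⟨F, rfl⟩
    exact exists_eq_of_groupDet F
  · rintro ⟨m, ℓ, β, hm, rfl⟩
    exact exists_groupDet_eq hm ℓ β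

/-- Modulo 7 the norm is `m ^ 2`, and `m ^ 7 ≡ m` by Fermat. -/
theorem mul_norm7_modEq (m ℓ β : ℤ) : m * norm7 (m + 7 * ℓ) β ^ 3 ≡ m [ZMOD 7] := by
  refine (ZMod.intCast_eq_intCast_iff _ _ 7).mp ?_
  rw [norm7]
  push_cast
  rw [show (7 : ZMod 7) = 0 from rfl, show (14 : ZMod 7) = 0 from rfl]
  generalize (m : ZMod 7) = x
  generalize (ℓ : ZMod 7) = y
  generalize (β : ZMod 7) = z
  ring_nf
  revert x; decide

theorem not_three_dvd_or_nine_dvd_mul_cube {m : ℤ} (hm : ¬ 3 ∣ m ∨ 9 ∣ m) (n : ℤ) :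
    ¬ 3 ∣ m * n ^ 3 ∨ 9 ∣ m * n ^ 3 := by
  rcases hm with hm | hm
  · by_cases hn : 3 ∣ n
    · exact .inr ((Dvd.intro _ rfl : (9 : ℤ) ∣ 9 * 3).trans (pow_dvd_pow_of_dvd hn 3) |>.mul_left m)
    · exact .inl fun h => (Int.prime_three.dvd_or_dvd h).elim hm
        fun h => hn (Int.prime_three.dvd_of_dvd_pow h)
  · exact .inr (hm.mul_right _)

end SmallGroup21

open SmallGroup21

theorem mainTheorem5 :
    integerGroupDets SmallGroup21 =
      {D : ℤ | ∃ m ℓ β : ℤ, (¬ 3 ∣ m ∨ 9 ∣ m) ∧ IsNormForm21 m ℓ β D} ∧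
    {D : ℤ | D ∈ integerGroupDets SmallGroup21 ∧ 7 ∣ D} =
      {D : ℤ | ∃ m : ℤ, (¬ 3 ∣ m ∨ 9 ∣ m) ∧ D = 7 ^ 4 * m} ∧
    {D : ℤ | D ∈ integerGroupDets SmallGroup21 ∧ (D ≡ 1 [ZMOD 7] ∨ D ≡ -1 [ZMOD 7])} =
      {D : ℤ | (D ≡ 1 [ZMOD 7] ∨ D ≡ -1 [ZMOD 7]) ∧ (¬ 3 ∣ D ∨ 9 ∣ D)} ∧
    {D : ℤ | D ∈ integerGroupDets SmallGroup21 ∧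
        (D ≡ 2 [ZMOD 7] ∨ D ≡ -2 [ZMOD 7] ∨ D ≡ 3 [ZMOD 7] ∨ D ≡ -3 [ZMOD 7])} =
      {D : ℤ | ∃ m ℓ β : ℤ,
        (m ≡ 2 [ZMOD 7] ∨ m ≡ -2 [ZMOD 7] ∨ m ≡ 3 [ZMOD 7] ∨ m ≡ -3 [ZMOD 7]) ∧
        (¬ 3 ∣ m ∨ 9 ∣ m) ∧ IsNormForm21 m ℓ β D} := by
  simp only [isNormForm21_iff, integerGroupDets_eq]
  refine ⟨trivial, ?_, ?_, ?_⟩ <;> ext D <;> constructor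
  · rintro ⟨⟨m, ℓ, β, hm, rfl⟩, hD⟩
    obtain ⟨n, rfl⟩ : 7 ∣ m :=
      (mul_norm7_modEq m ℓ β).dvd_iff.mp hD
    refine ⟨n * (7 * (n + ℓ) ^ 2 + 7 * (n + ℓ) * β + 2 * β ^ 2) ^ 3, ?_, by rw [norm7]; ring⟩
    exact not_three_dvd_or_nine_dvd_mul_cube (by omega) _
  -- Here `m + 7ℓ = -7` and `β = 2`, which has norm `49 - 98 + 56 = 7`.
  · rintro ⟨n, hn, rfl⟩
    exact ⟨⟨7 * n, -n - 1, 2, by omega, by rw [norm7]; ring⟩, Dvd.intro (7 ^ 3 * n) (by ring)⟩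
  · rintro ⟨⟨m, ℓ, β, hm, rfl⟩, hD⟩
    exact ⟨hD, not_three_dvd_or_nine_dvd_mul_cube hm _⟩
  · rintro ⟨hD, h3⟩
    refine ⟨?_, hD⟩
    -- The choice of `c` makes `D + 7c = ±1`, of norm 1.
    rcases hD with h | h
    · obtain ⟨c, hc⟩ := h.dvd
      exact ⟨D, c, 0, h3, by rw [norm7, ← hc]; ring⟩
    · obtain ⟨c, hc⟩ := h.dvd
      exact ⟨D, c, 0, h3, by rw [norm7, ← hc]; ring⟩
  · rintro ⟨⟨m, ℓ, β, hm, rfl⟩, hD⟩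
    have h := (mul_norm7_modEq m ℓ β).symm
    exact ⟨m, ℓ, β, hD.imp h.trans (.imp h.trans (.imp h.trans h.trans)), hm, rfl⟩
  · rintro ⟨m, ℓ, β, hD, hm, rfl⟩
    have h := mul_norm7_modEq m ℓ β
    exact ⟨⟨m, ℓ, β, hm, rfl⟩, hD.imp h.trans (.imp h.trans (.imp h.trans h.trans))⟩
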